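/- **Conventions.** Let $\bar M$ be a smooth manifold of dimension $2n+s$. A *metric $f$-structure* on $\bar M$ consists of a smooth $(1,1)$-tensor field $\varphi$ with $\varphi^3+\varphi=0$, smooth vector fields $\xi_1,\dots,\xi_s$, smooth $1$-forms $\eta^1,\dots,\eta^s$ and a Riemannian metric $\bar g$ such that $$\varphi^2=-I+\sum_{i=1}^s\eta^i\otimes\xi_i,\qquad \eta^i(\xi_j)=\delta_{ij},\qquad \bar g(\varphi X,\varphi Y)=\bar g(X,Y)-\sum_{i=1}^s\eta^i(X)\eta^i(Y).$$ Put $\Phi(X,Y)=\bar g(X,\varphi Y)$. The manifold $(\bar M,\varphi,\xi_i,\eta^i,\bar g)$ is a *generalized Kenmotsu manifold* if $s\ge 1$, $\eta^1\wedge\dots\wedge\eta^s\wedge\Phi^n\ne 0$ at every point, all $\eta^i$ are closed, $d\Phi=2\sum_{i=1}^s\eta^i\wedge\Phi$, and the structure is normal, i.e. $[\varphi,\varphi]+2\sum_{i=1}^s d\eta^i\otimes\xi_i=0$, where $[\varphi,\varphi]$ is the Nijenhuis tensor of $\varphi$. Let $\bar\nabla$ be the Levi-Civita connection of $\bar g$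 and $\bar R(X,Y)=\bar\nabla_X\bar\nabla_Y-\bar\nabla_Y\bar\nabla_X-\bar\nabla_{[X,Y]}$. An (immersed) submanifold $M$ of $\bar M$ is *invariant* if $\varphi(T_xM)\subset T_xM$ for every $x\in M$ and all $\xi_1,\dots,\xi_s$ are tangent to $M$ at every point of $M$. **Theorem.** Let $M$ be an invariant submanifold of a $(2n+s)$-dimensional generalized Kenmotsu manifold $\bar M$. Then for all $X,Y\in\Gamma(TM)$ and every $j\in\{1,\dots,s\}$, the vector field $\bar R(X,Y)\xi_j$ along $M$ is tangent to $M$. (Here $\bar R(X,Y)\xi_j$ at $x\in M$ is computed with any local smooth extensions of $X_x,Y_x$ to vector fields on $\bar M$.) -/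

import Mathlib

open Bundle
open scoped Manifold ContDiff

namespace GenKenmotsu

/-! ### Vector fields, Levi-Civita connection and curvature -/

/-- Vector fields on a `d`-dimensional manifold (no smoothness required). -/
abbrev VField (d : ℕ) (M : Type*) [TopologicalSpace M]
    [ChartedSpace (EuclideanSpace ℝ (Fin d)) M] : Type _ :=
  (x : M) → TangentSpace (𝓡 d) x

/-- The vector field `X` is smooth at `x`. -/
def SmoothAt {d : ℕ} {M : Type*} [TopologicalSpace M]
    [ChartedSpace (EuclideanSpace ℝ (Fin d)) M] [IsManifold (𝓡 d) ∞ M]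
    (X : VField d M) (x : M) : Prop :=
  ContMDiffAt (𝓡 d) (𝓡 d).tangent ∞ (fun y ↦ (⟨y, X y⟩ : TangentBundle (𝓡 d) M)) x

/-- The vector field `X` is differentiable at `x`. -/
def DiffAt {d : ℕ} {M : Type*} [TopologicalSpace M]
    [ChartedSpace (EuclideanSpace ℝ (Fin d)) M] [IsManifold (𝓡 d) ∞ M]
    (X : VField d M) (x : M) : Prop :=
  MDifferentiableAt (𝓡 d) (𝓡 d).tangent (fun y ↦ (⟨y, X y⟩ : TangentBundle (𝓡 d) M)) x

/-- The derivative `X f` of a function `f` along a vector field `X`, at `x`. -/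
noncomputable def dirDeriv {d : ℕ} {M : Type*} [TopologicalSpace M]
    [ChartedSpace (EuclideanSpace ℝ (Fin d)) M]
    (X : VField d M) (f : M → ℝ) (x : M) : ℝ :=
  mvfderiv (𝓡 d) f x (X x)

/-- The Lie bracket `[X, Y]`. -/
noncomputable abbrev bracket {d : ℕ} {M : Type*} [TopologicalSpace M]
    [ChartedSpace (EuclideanSpace ℝ (Fin d)) M]
    (X Y : VField d M) : VField d M :=
  VectorField.mlieBracket (𝓡 d) X Y

/-- Smooth Riemannian metrics. -/
abbrev Metric (d : ℕ) (M : Type*) [TopologicalSpace M]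
    [ChartedSpace (EuclideanSpace ℝ (Fin d)) M] [IsManifold (𝓡 d) ∞ M] : Type _ :=
  ContMDiffRiemannianMetric (𝓡 d) ∞ (EuclideanSpace ℝ (Fin d))
    (fun x : M ↦ TangentSpace (𝓡 d) x)

/-- The function `g(X, Y)`. -/
noncomputable def Metric.pair {d : ℕ} {M : Type*} [TopologicalSpace M]
    [ChartedSpace (EuclideanSpace ℝ (Fin d)) M] [IsManifold (𝓡 d) ∞ M]
    (g : Metric d M) (X Y : VField d M) (x : M) : ℝ :=
  g.inner x (X x) (Y x)

/-- The right-hand side of the Koszul formula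
`2 g(∇_X Y, Z) = X g(Y,Z) + Y g(X,Z) - Z g(X,Y) + g([X,Y],Z) - g([X,Z],Y) - g([Y,Z],X)`. -/
noncomputable def koszul {d : ℕ} {M : Type*} [TopologicalSpace M]
    [ChartedSpace (EuclideanSpace ℝ (Fin d)) M] [IsManifold (𝓡 d) ∞ M]
    (g : Metric d M) (X Y Z : VField d M) (x : M) : ℝ :=
  dirDeriv X (g.pair Y Z) x + dirDeriv Y (g.pair X Z) x - dirDeriv Z (g.pair X Y) x
    + g.pair (bracket X Y) Z x - g.pair (bracket X Z) Y x - g.pair (bracket Y Z) X x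

/-- The Levi-Civita connection: `(∇_X Y)(x)` is the vector determined by the Koszul formula.
It exists and is unique when `X` and `Y` are differentiable at `x`, see `leviCivita_spec` and
`leviCivita_unique`. -/
noncomputable def leviCivita {d : ℕ} {M : Type*} [TopologicalSpace M]
    [ChartedSpace (EuclideanSpace ℝ (Fin d)) M] [IsManifold (𝓡 d) ∞ M]
    (g : Metric d M) (X Y : VField d M) : VField d M := fun x ↦
  Classical.epsilon fun v : TangentSpace (𝓡 d) x ↦
    ∀ Z : VField d M, DiffAt Z x → 2 * g.inner x v (Z x) = koszul g X Y Z x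

/-- The curvature `R(X,Y)Z = ∇_X ∇_Y Z - ∇_Y ∇_X Z - ∇_[X,Y] Z` of the Levi-Civita connection. -/
noncomputable def curvature {d : ℕ} {M : Type*} [TopologicalSpace M]
    [ChartedSpace (EuclideanSpace ℝ (Fin d)) M] [IsManifold (𝓡 d) ∞ M]
    (g : Metric d M) (X Y Z : VField d M) : VField d M := fun x ↦
  leviCivita g X (leviCivita g Y Z) x - leviCivita g Y (leviCivita g X Z) x
    - leviCivita g (bracket X Y) Z x

theorem pair_diff {d : ℕ} {M : Type*} [TopologicalSpace M]
    [ChartedSpace (EuclideanSpace ℝ (Fin d)) M] [IsManifold (𝓡 d) ∞ M]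
    (g : Metric d M) {X Y : VField d M} {x : M} (hX : DiffAt X x) (hY : DiffAt Y x) :
    MDifferentiableAt (𝓡 d) 𝓘(ℝ, ℝ) (g.pair X Y) x := by
  let _ : RiemannianBundle (fun x : M ↦ TangentSpace (𝓡 d) x) := ⟨g.toRiemannianMetric⟩
  have : IsContMDiffRiemannianBundle (𝓡 d) ∞ (EuclideanSpace ℝ (Fin d))
    (fun x : M ↦ TangentSpace (𝓡 d) x) := ⟨g.inner, g.contMDiff, fun _ _ _ ↦ rfl⟩
  exact MDifferentiableAt.inner_bundle (IB := 𝓡 d) (F := EuclideanSpace ℝ (Fin d))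
    (E := fun x : M ↦ TangentSpace (𝓡 d) x) (b := fun x ↦ x) hX hY

theorem koszul_tensorial {d : ℕ} {M : Type*} [TopologicalSpace M]
    [ChartedSpace (EuclideanSpace ℝ (Fin d)) M] [IsManifold (𝓡 d) ∞ M]
    (g : Metric d M) {X Y : VField d M} {x : M} (hX : DiffAt X x) (hY : DiffAt Y x) :
    TensorialAt (𝓡 d) (EuclideanSpace ℝ (Fin d)) (fun Z : VField d M ↦ koszul g X Y Z x) x where
  smul {f Z} hf hZ := by
    have e1 (W : VField d M) : g.pair W (f • Z) = fun y ↦ f y * g.pair W Z y := by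
      ext y; simp [Metric.pair]
    simp only [koszul, e1, dirDeriv, bracket]
    rw [mvfderiv_fun_mul hf (pair_diff g hY hZ), mvfderiv_fun_mul hf (pair_diff g hX hZ)]
    simp only [Metric.pair, VectorField.mlieBracket_smul_right hf hZ]
    simp [g.symm x (Z x)]
    ring
  add {Z Z'} hZ hZ' := by
    have e1 (W : VField d M) : g.pair W (Z + Z') = fun y ↦ g.pair W Z y + g.pair W Z' y := by
      ext y; simp [Metric.pair]
    simp only [koszul, e1, dirDeriv, bracket]
    rw [mvfderiv_fun_add (pair_diff g hY hZ) (pair_diff g hY hZ'),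
      mvfderiv_fun_add (pair_diff g hX hZ) (pair_diff g hX hZ')]
    simp only [Metric.pair, VectorField.mlieBracket_add_right hZ hZ']
    simp
    ring

/-- Existence: the Koszul formula holds for the connection just defined. -/
theorem leviCivita_spec {d : ℕ} {M : Type*} [TopologicalSpace M]
    [ChartedSpace (EuclideanSpace ℝ (Fin d)) M] [IsManifold (𝓡 d) ∞ M]
    (g : Metric d M) {X Y : VField d M} {x : M} (hX : DiffAt X x) (hY : DiffAt Y x)
    {Z : VField d M} (hZ : DiffAt Z x) :
    2 * g.inner x (leviCivita g X Y x) (Z x) = koszul g X Y Z x := by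
  have key : ∃ v : TangentSpace (𝓡 d) x,
      ∀ Z : VField d M, DiffAt Z x → 2 * g.inner x v (Z x) = koszul g X Y Z x := by
    have hT := koszul_tensorial g hX hY
    let L := TensorialAt.mkHom _ x hT
    let B : TangentSpace (𝓡 d) x →ₗ[ℝ] (TangentSpace (𝓡 d) x →ₗ[ℝ] ℝ) :=
      { toFun := fun v ↦ (g.inner x v).toLinearMap
        map_add' := by intros; ext; simp
        map_smul' := by intros; ext; simp }
    have : FiniteDimensional ℝ (TangentSpace (𝓡 d) x) :=
      inferInstanceAs (FiniteDimensional ℝ (EuclideanSpace ℝ (Fin d)))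
    have hinj : Function.Injective B := by
      rw [injective_iff_map_eq_zero]
      intro v hv
      by_contra h
      have := g.pos x v h
      have h2 : B v v = 0 := by rw [hv]; rfl
      exact this.ne' h2
    have hsurj : Function.Surjective B :=
      (LinearMap.injective_iff_surjective_of_finrank_eq_finrank
        (Subspace.dual_finrank_eq (K := ℝ)).symm).1 hinj
    obtain ⟨v, hv⟩ := hsurj ((1 / 2 : ℝ) • L.toLinearMap)
    refine ⟨v, fun Z hZ ↦ ?_⟩
    have h1 : g.inner x v (Z x) = (1 / 2 : ℝ) * L (Z x) := congrArg (fun f ↦ f (Z x)) hv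
    have h2 : L (Z x) = koszul g X Y Z x := TensorialAt.mkHom_apply hT hZ
    rw [h1, h2]; ring
  exact Classical.epsilon_spec key Z hZ

/-- Uniqueness: a vector satisfying the Koszul formula is determined by it. -/
theorem leviCivita_unique {d : ℕ} {M : Type*} [TopologicalSpace M]
    [ChartedSpace (EuclideanSpace ℝ (Fin d)) M] [IsManifold (𝓡 d) ∞ M]
    (g : Metric d M) {x : M} {v w : TangentSpace (𝓡 d) x}
    (h : ∀ Z : VField d M, DiffAt Z x → 2 * g.inner x v (Z x) = 2 * g.inner x w (Z x)) :
    v = w := by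
  by_contra hne
  have hp := g.pos x (v - w) (sub_ne_zero.2 hne)
  have := h (FiberBundle.extend (EuclideanSpace ℝ (Fin d)) (v - w))
    (FiberBundle.mdifferentiableAt_extend ..)
  rw [FiberBundle.extend_apply_self] at this
  have hs : g.inner x (v - w) (v - w) = g.inner x v (v - w) - g.inner x w (v - w) := by
    conv_lhs => rw [map_sub (g.inner x) v w]
    rfl
  linarith

/-! ### Metric `f`-manifolds and generalized Kenmotsu manifolds -/

/-- A metric `f`-structure `(φ, ξ_i, η^i, g)` on a manifold of dimension `2n + s`: an `f`-structure
`φ`, that is `φ³ + φ = 0`, with `φ² = -I + ∑ η^i ⊗ ξ_i`, `η^i(ξ_j) = δ_ij` and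
`g(φX, φY) = g(X,Y) - ∑ η^i(X) η^i(Y)`, all data being smooth. -/
structure MetricFStructure (n s : ℕ) (M : Type*) [TopologicalSpace M]
    [ChartedSpace (EuclideanSpace ℝ (Fin (2 * n + s))) M] [IsManifold (𝓡 (2 * n + s)) ∞ M] where
  φ : (x : M) → TangentSpace (𝓡 (2 * n + s)) x →L[ℝ] TangentSpace (𝓡 (2 * n + s)) x
  ξ : Fin s → VField (2 * n + s) M
  η : Fin s → (x : M) → TangentSpace (𝓡 (2 * n + s)) x →L[ℝ] ℝ
  g : Metric (2 * n + s) M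
  smooth_φ : ContMDiff (𝓡 (2 * n + s))
    ((𝓡 (2 * n + s)).prod
      𝓘(ℝ, EuclideanSpace ℝ (Fin (2 * n + s)) →L[ℝ] EuclideanSpace ℝ (Fin (2 * n + s)))) ∞
    (fun x ↦ TotalSpace.mk'
      (EuclideanSpace ℝ (Fin (2 * n + s)) →L[ℝ] EuclideanSpace ℝ (Fin (2 * n + s))) x (φ x))
  smooth_ξ : ∀ i x, SmoothAt (ξ i) x
  smooth_η : ∀ i, ContMDiff (𝓡 (2 * n + s))
    ((𝓡 (2 * n + s)).prod 𝓘(ℝ, EuclideanSpace ℝ (Fin (2 * n + s)) →L[ℝ] ℝ)) ∞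
    (fun x ↦ TotalSpace.mk' (EuclideanSpace ℝ (Fin (2 * n + s)) →L[ℝ] ℝ) x (η i x))
  φ_cube : ∀ x (v : TangentSpace (𝓡 (2 * n + s)) x), φ x (φ x (φ x v)) + φ x v = 0
  φ_sq : ∀ x (v : TangentSpace (𝓡 (2 * n + s)) x),
    φ x (φ x v) = -v + ∑ i, η i x v • ξ i x
  η_ξ : ∀ x i j, η i x (ξ j x) = if i = j then 1 else 0
  g_φ : ∀ x (v w : TangentSpace (𝓡 (2 * n + s)) x),
    g.inner x (φ x v) (φ x w) = g.inner x v w - ∑ i, η i x v * η i x w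

namespace MetricFStructure

variable {n s : ℕ} {M : Type*} [TopologicalSpace M]
  [ChartedSpace (EuclideanSpace ℝ (Fin (2 * n + s))) M] [IsManifold (𝓡 (2 * n + s)) ∞ M]

/-- The fundamental 2-form `Φ(X,Y) = g(X, φY)`. -/
noncomputable def fundForm (S : MetricFStructure n s M) (x : M)
    (v w : TangentSpace (𝓡 (2 * n + s)) x) : ℝ :=
  S.g.inner x v (S.φ x w)

/-- The vector field `φX`. -/
noncomputable def φField (S : MetricFStructure n s M) (X : VField (2 * n + s) M) : VField (2 * n + s) M :=
  fun x ↦ S.φ x (X x)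

/-- A positive multiple of `(η^1 ∧ ⋯ ∧ η^s ∧ Φ^n)` at `x`, evaluated on `2n + s` tangent vectors:
the alternation of `η^1 ⊗ ⋯ ⊗ η^s ⊗ Φ ⊗ ⋯ ⊗ Φ`. -/
noncomputable def topForm (S : MetricFStructure n s M) (x : M)
    (v : Fin s ⊕ Fin n × Fin 2 → TangentSpace (𝓡 (2 * n + s)) x) : ℝ :=
  ∑ σ : Equiv.Perm (Fin s ⊕ Fin n × Fin 2), ((Equiv.Perm.sign σ : ℤ) : ℝ) *
    ((∏ i : Fin s, S.η i x (v (σ (Sum.inl i)))) *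
      ∏ k : Fin n, S.fundForm x (v (σ (Sum.inr (k, 0)))) (v (σ (Sum.inr (k, 1)))))

/-- Almost `s`-contact metric structure: `η^1 ∧ ⋯ ∧ η^s ∧ Φ^n ≠ 0` at every point. -/
def IsAlmostSContact (S : MetricFStructure n s M) : Prop :=
  ∀ x, ∃ v, S.topForm x v ≠ 0

/-- `dη^i(X,Y) = ½ (X η^i(Y) - Y η^i(X) - η^i([X,Y]))`. -/
noncomputable def dη (S : MetricFStructure n s M) (i : Fin s) (X Y : VField (2 * n + s) M)
    (x : M) : ℝ :=
  (1 / 2) * (dirDeriv X (fun y ↦ S.η i y (Y y)) x - dirDeriv Y (fun y ↦ S.η i y (X y)) x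
    - S.η i x (bracket X Y x))

/-- The function `Φ(X,Y)`. -/
noncomputable def Φ (S : MetricFStructure n s M) (X Y : VField (2 * n + s) M) (x : M) : ℝ :=
  S.fundForm x (X x) (Y x)

/-- `dΦ(X,Y,Z)`, equal to one third of
`X Φ(Y,Z) + Y Φ(Z,X) + Z Φ(X,Y) - Φ([X,Y],Z) - Φ([Y,Z],X) - Φ([Z,X],Y)`. -/
noncomputable def dΦ (S : MetricFStructure n s M) (X Y Z : VField (2 * n + s) M) (x : M) : ℝ :=
  (1 / 3) * (dirDeriv X (S.Φ Y Z) x + dirDeriv Y (S.Φ Z X) x + dirDeriv Z (S.Φ X Y) x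
    - S.Φ (bracket X Y) Z x - S.Φ (bracket Y Z) X x - S.Φ (bracket Z X) Y x)

/-- `(η^i ∧ Φ)(X,Y,Z) = ⅓ (η^i(X) Φ(Y,Z) + η^i(Y) Φ(Z,X) + η^i(Z) Φ(X,Y))`, the wedge product in the
same normalization as the exterior derivatives above. -/
noncomputable def ηwedgeΦ (S : MetricFStructure n s M) (i : Fin s) (X Y Z : VField (2 * n + s) M)
    (x : M) : ℝ :=
  (1 / 3) * (S.η i x (X x) * S.Φ Y Z x + S.η i x (Y x) * S.Φ Z X x + S.η i x (Z x) * S.Φ X Y x)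

/-- The Nijenhuis tensor `[φ,φ](X,Y) = φ²[X,Y] + [φX,φY] - φ[φX,Y] - φ[X,φY]`. -/
noncomputable def nijenhuis (S : MetricFStructure n s M) (X Y : VField (2 * n + s) M) (x : M) :
    TangentSpace (𝓡 (2 * n + s)) x :=
  S.φ x (S.φ x (bracket X Y x)) + bracket (S.φField X) (S.φField Y) x
    - S.φ x (bracket (S.φField X) Y x) - S.φ x (bracket X (S.φField Y) x)

/-- Normality: `[φ,φ] + 2 ∑ dη^i ⊗ ξ_i = 0`. -/
def IsNormal (S : MetricFStructure n s M) : Prop :=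
  ∀ (x : M) (X Y : VField (2 * n + s) M), SmoothAt X x → SmoothAt Y x →
    S.nijenhuis X Y x + (2 : ℝ) • ∑ i, S.dη i X Y x • S.ξ i x = 0

/-- Generalized almost Kenmotsu: an almost `s`-contact metric structure with `s ≥ 1`, all `η^i`
closed, and `dΦ = 2 ∑ η^i ∧ Φ`. -/
structure IsGenAlmostKenmotsu (S : MetricFStructure n s M) : Prop where
  one_le : 1 ≤ s
  almostSContact : S.IsAlmostSContact
  closed : ∀ (i : Fin s) (x : M) (X Y : VField (2 * n + s) M), SmoothAt X x → SmoothAt Y x →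
    S.dη i X Y x = 0
  dΦ_eq : ∀ (x : M) (X Y Z : VField (2 * n + s) M), SmoothAt X x → SmoothAt Y x → SmoothAt Z x →
    S.dΦ X Y Z x = 2 * ∑ i, S.ηwedgeΦ i X Y Z x

/-- Generalized Kenmotsu: normal generalized almost Kenmotsu. -/
structure IsGenKenmotsu (S : MetricFStructure n s M) : Prop extends
    S.IsGenAlmostKenmotsu where
  normal : S.IsNormal

end MetricFStructure

/-! ### Invariant submanifolds -/

/-- The tangent space `T_pM`, as a subspace of the ambient tangent space at `f p`. -/
noncomputable def tangentSub (d m : ℕ) {N M : Type*} [TopologicalSpace N]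
    [ChartedSpace (EuclideanSpace ℝ (Fin d)) N] [TopologicalSpace M]
    [ChartedSpace (EuclideanSpace ℝ (Fin m)) M] (f : M → N) (p : M) :
    Submodule ℝ (TangentSpace (𝓡 d) (f p)) :=
  LinearMap.range (mfderiv (𝓡 m) (𝓡 d) f p).toLinearMap

/-- The (immersed) submanifold `f : M → N` is invariant: each `φ` maps `T_pM` into itself and all
the `ξ_i` are tangent to `M`. -/
structure IsInvariantSubmanifold {n s : ℕ} (m : ℕ) {N M : Type*} [TopologicalSpace N]
    [ChartedSpace (EuclideanSpace ℝ (Fin (2 * n + s))) N] [IsManifold (𝓡 (2 * n + s)) ∞ N]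
    [TopologicalSpace M] [ChartedSpace (EuclideanSpace ℝ (Fin m)) M]
    (S : MetricFStructure n s N) (f : M → N) : Prop where
  immersion : Manifold.IsImmersion (𝓡 m) (𝓡 (2 * n + s)) ∞ f
  φ_mem : ∀ p, ∀ v ∈ tangentSub (2 * n + s) m f p, S.φ (f p) v ∈ tangentSub (2 * n + s) m f p
  ξ_mem : ∀ i p, S.ξ i (f p) ∈ tangentSub (2 * n + s) m f p

end GenKenmotsu

namespace GenKenmotsu

/-! ### General facts on the Levi-Civita connection -/

section Connection

variable {d : ℕ} {M : Type*} [TopologicalSpace M] [ChartedSpace (EuclideanSpace ℝ (Fin d)) M]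

/-! The curvature `R(X,Y)ξ_j` is a linear combination of `X`, `Y` and the `ξ_k`, all of which lie in
the tangent space of the submanifold.

The formula comes from the flow of `ξ_j`. Closedness gives `L_ξ η = 0`, and normality then gives
`L_ξ φ = 0`. Contracting `dΦ = 2 ∑ η^i ∧ Φ` with `ξ_j`, where `Φ(ξ_j, ·) = 0`, gives `L_ξ Φ = 2Φ`.
Since `g = Φ(φ·, ·) + ∑ η^i ⊗ η^i`, these combine to `L_ξ g = 2(g - ∑ η^i ⊗ η^i)` (`lie_ξ_g`). By
Koszul, `2g(∇_X ξ_j, Z)` is `(L_ξ g)(X,Z)` plus a multiple of `dη^j(X,Z) = 0`, so `∇_X ξ_j = X - ∑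
η^i(X) ξ_i` (`leviCivita_ξ`). Differentiating once more and antisymmetrising yields `curvature_ξ`.
-/

theorem dirDeriv_const (X : VField d M) (c : ℝ) (x : M) : dirDeriv X (fun _ ↦ c) x = 0 := by
  simp [dirDeriv, mvfderiv_const]

theorem dirDeriv_congr (X : VField d M) {a b : M → ℝ} {x : M} (h : a =ᶠ[nhds x] b) :
    dirDeriv X a x = dirDeriv X b x := by
  have : mvfderiv (𝓡 d) a x = mvfderiv (𝓡 d) b x := by
    simp only [mvfderiv]
    rw [h.mfderiv_eq, h.self_of_nhds]
  simp [dirDeriv, this]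

theorem dirDeriv_sub (X : VField d M) {a b : M → ℝ} {x : M}
    (ha : MDifferentiableAt (𝓡 d) 𝓘(ℝ, ℝ) a x) (hb : MDifferentiableAt (𝓡 d) 𝓘(ℝ, ℝ) b x) :
    dirDeriv X (fun y ↦ a y - b y) x = dirDeriv X a x - dirDeriv X b x := by
  simp only [dirDeriv]
  rw [mvfderiv_fun_sub ha hb]
  rfl

theorem dirDeriv_add (X : VField d M) {a b : M → ℝ} {x : M}
    (ha : MDifferentiableAt (𝓡 d) 𝓘(ℝ, ℝ) a x) (hb : MDifferentiableAt (𝓡 d) 𝓘(ℝ, ℝ) b x) :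
    dirDeriv X (fun y ↦ a y + b y) x = dirDeriv X a x + dirDeriv X b x := by
  simp only [dirDeriv]
  rw [mvfderiv_fun_add ha hb]
  rfl

theorem dirDeriv_mul (X : VField d M) {a b : M → ℝ} {x : M}
    (ha : MDifferentiableAt (𝓡 d) 𝓘(ℝ, ℝ) a x) (hb : MDifferentiableAt (𝓡 d) 𝓘(ℝ, ℝ) b x) :
    dirDeriv X (fun y ↦ a y * b y) x = a x * dirDeriv X b x + b x * dirDeriv X a x := by
  simp only [dirDeriv]
  rw [mvfderiv_fun_mul ha hb]
  rfl

theorem mdifferentiableAt_finset_sum {ι : Type*} (t : Finset ι) {a : ι → M → ℝ} {x : M}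
    (ha : ∀ i ∈ t, MDifferentiableAt (𝓡 d) 𝓘(ℝ, ℝ) (a i) x) :
    MDifferentiableAt (𝓡 d) 𝓘(ℝ, ℝ) (fun y ↦ ∑ i ∈ t, a i y) x := by
  classical
  induction t using Finset.induction_on with
  | empty => simpa using mdifferentiableAt_const
  | insert i t hi ih =>
    simp only [Finset.sum_insert hi]
    exact (ha i (by simp)).add (ih fun k hk ↦ ha k (by simp [hk]))

theorem dirDeriv_sum (X : VField d M) {ι : Type*} (t : Finset ι) {a : ι → M → ℝ} {x : M}
    (ha : ∀ i ∈ t, MDifferentiableAt (𝓡 d) 𝓘(ℝ, ℝ) (a i) x) :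
    dirDeriv X (fun y ↦ ∑ i ∈ t, a i y) x = ∑ i ∈ t, dirDeriv X (a i) x := by
  classical
  induction t using Finset.induction_on with
  | empty => simpa using dirDeriv_const X 0 x
  | insert i t hi ih =>
    have ht : ∀ k ∈ t, MDifferentiableAt (𝓡 d) 𝓘(ℝ, ℝ) (a k) x := fun k hk ↦ ha k (by simp [hk])
    simp only [Finset.sum_insert hi]
    rw [dirDeriv_add X (ha i (by simp)) (mdifferentiableAt_finset_sum t ht), ih ht]

variable [IsManifold (𝓡 d) ∞ M]

theorem SmoothAt.diffAt {X : VField d M} {x : M} (h : SmoothAt X x) : DiffAt X x :=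
  ContMDiffAt.mdifferentiableAt h (by simp)

theorem exists_smoothAt_extension {x : M} (v : TangentSpace (𝓡 d) x) :
    ∃ V : VField d M, SmoothAt V x ∧ V x = v :=
  ⟨FiberBundle.extend (EuclideanSpace ℝ (Fin d)) v,
    FiberBundle.contMDiffAt_extend (𝓡 d) (EuclideanSpace ℝ (Fin d)) v,
    FiberBundle.extend_apply_self ..⟩

theorem SmoothAt.eventually_diffAt {X : VField d M} {x : M} (h : SmoothAt X x) :
    ∀ᶠ y in nhds x, DiffAt X y := by
  -- Being `C^1` at a point is an open condition; for `C^∞` the neighbourhoods may shrink with the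
  -- order.
  have h1 : ContMDiffAt (𝓡 d) (𝓡 d).tangent 1
      (fun y ↦ (⟨y, X y⟩ : TangentBundle (𝓡 d) M)) x := ContMDiffAt.of_le h (by simp)
  filter_upwards [contMDiffAt_iff_contMDiffAt_nhds (by simp) |>.1 h1] with y hy
  exact hy.mdifferentiableAt (by simp)

theorem diffAt_bracket {X Y : VField d M} {x : M} (hX : SmoothAt X x) (hY : SmoothAt Y x) :
    DiffAt (bracket X Y) x := by
  have hle (k : ℕ) : (k : WithTop ℕ∞) ≤ ∞ := ENat.LEInfty.out
  have : IsManifold (𝓡 d) (minSmoothness ℝ 2) M := by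
    rw [minSmoothness_of_isRCLikeNormedField]
    exact .of_le (hle 2)
  have : IsManifold (𝓡 d) ((2 : ℕ∞) + 1) M := .of_le (hle 3)
  have h := ContMDiffAt.mlieBracket_vectorField (m := 1) (n := 2) (I := 𝓡 d) (M := M)
    (ContMDiffAt.of_le hX (hle 2)) (ContMDiffAt.of_le hY (hle 2))
    (by rw [minSmoothness_of_isRCLikeNormedField]; exact le_of_eq one_add_one_eq_two)
  exact h.mdifferentiableAt (by simp)

/-! ### Rules of calculus for the Levi-Civita connection -/

variable (g : Metric d M)

theorem Metric.pair_comm (X Y : VField d M) : g.pair X Y = g.pair Y X := by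
  ext x; exact g.symm x _ _

/-- The terms in `Y f` and `Z f` produced by the product rule cancel those produced by the brackets
`[fX,Y]` and `[fX,Z]`. -/
theorem koszul_tensorial_left {Y Z : VField d M} {x : M} (hY : DiffAt Y x) (hZ : DiffAt Z x) :
    TensorialAt (𝓡 d) (EuclideanSpace ℝ (Fin d)) (fun X : VField d M ↦ koszul g X Y Z x) x where
  smul {f X} hf hX := by
    have e1 (W : VField d M) : g.pair (f • X) W = fun y ↦ f y * g.pair X W y := by
      ext y; simp [Metric.pair]
    simp only [koszul, g.pair_comm (bracket Y Z), e1, dirDeriv, bracket]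
    rw [mvfderiv_fun_mul hf (pair_diff g hX hZ), mvfderiv_fun_mul hf (pair_diff g hX hY)]
    simp only [Metric.pair, VectorField.mlieBracket_smul_left hf hX]
    simp [g.symm x (X x)]
    ring
  add {X X'} hX hX' := by
    have e1 (W : VField d M) : g.pair (X + X') W = fun y ↦ g.pair X W y + g.pair X' W y := by
      ext y; simp [Metric.pair]
    simp only [koszul, g.pair_comm (bracket Y Z), e1, dirDeriv, bracket]
    rw [mvfderiv_fun_add (pair_diff g hX hZ) (pair_diff g hX' hZ),
      mvfderiv_fun_add (pair_diff g hX hY) (pair_diff g hX' hY)]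
    simp only [Metric.pair, VectorField.mlieBracket_add_left hX hX']
    simp
    ring

/-- It suffices to test a candidate for `∇_X Y` on smooth vector fields. -/
theorem leviCivita_eq {X Y : VField d M} {x : M} {v : TangentSpace (𝓡 d) x} (hX : DiffAt X x)
    (hY : DiffAt Y x) (h : ∀ Z : VField d M, SmoothAt Z x →
      koszul g X Y Z x = 2 * g.inner x v (Z x)) : leviCivita g X Y x = v := by
  refine leviCivita_unique g fun Z _ ↦ ?_
  obtain ⟨Z', hZ', hZx⟩ := exists_smoothAt_extension (Z x)
  rw [← hZx, leviCivita_spec g hX hY hZ'.diffAt, h Z' hZ']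

/-- Allows a merely differentiable `X`, such as a bracket, to be replaced by a smooth field with the
same value, to which the structure equations apply. -/
theorem leviCivita_congr_left {X X' Y : VField d M} {x : M} (hX : DiffAt X x)
    (hX' : DiffAt X' x) (hY : DiffAt Y x) (h : X x = X' x) :
    leviCivita g X Y x = leviCivita g X' Y x := by
  refine leviCivita_eq g hX hY fun Z hZ ↦ ?_
  rw [leviCivita_spec g hX' hY hZ.diffAt]
  exact (koszul_tensorial_left g hY hZ.diffAt).pointwise hX hX' h

/-- The Koszul expression sees only the germ of `Y`, so both defining conditions coincide and no
differentiability is needed. -/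
theorem leviCivita_congr_right {X Y Y' : VField d M} {x : M} (h : Y =ᶠ[nhds x] Y') :
    leviCivita g X Y x = leviCivita g X Y' x := by
  have key (Z : VField d M) : koszul g X Y Z x = koszul g X Y' Z x := by
    have h1 : g.pair Y Z =ᶠ[nhds x] g.pair Y' Z := by
      filter_upwards [h] with y hy; simp [Metric.pair, hy]
    have h2 : g.pair X Y =ᶠ[nhds x] g.pair X Y' := by
      filter_upwards [h] with y hy; simp [Metric.pair, hy]
    have h3 : bracket X Y x = bracket X Y' x :=
      Filter.EventuallyEq.mlieBracket_vectorField_eq (.refl _ _) h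
    have h4 : bracket Y Z x = bracket Y' Z x :=
      h.mlieBracket_vectorField_eq (.refl _ _)
    have h5 : dirDeriv Y (g.pair X Z) x = dirDeriv Y' (g.pair X Z) x := by
      simp [dirDeriv, h.self_of_nhds]
    simp only [koszul, dirDeriv_congr X h1, dirDeriv_congr Z h2, h5]
    simp only [Metric.pair, h3, h4, h.self_of_nhds]
  simp only [leviCivita, key]

theorem leviCivita_add {X Y Y' : VField d M} {x : M} (hX : DiffAt X x) (hY : DiffAt Y x)
    (hY' : DiffAt Y' x) :
    leviCivita g X (Y + Y') x = leviCivita g X Y x + leviCivita g X Y' x := by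
  refine leviCivita_eq g hX (mdifferentiableAt_add_section hY hY') fun Z hZ ↦ ?_
  have hZ := hZ.diffAt
  have e1 (W : VField d M) : g.pair (Y + Y') W = fun y ↦ g.pair Y W y + g.pair Y' W y := by
    ext y; simp [Metric.pair]
  have s1 := leviCivita_spec g hX hY hZ
  have s2 := leviCivita_spec g hX hY' hZ
  simp only [map_add, add_apply, mul_add, s1, s2]
  simp only [koszul, g.pair_comm X (Y + Y'), g.pair_comm X Y, g.pair_comm X Y',
    g.pair_comm (bracket X Z), e1]
  rw [dirDeriv_add X (pair_diff g hY hZ) (pair_diff g hY' hZ),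
    dirDeriv_add Z (pair_diff g hY hX) (pair_diff g hY' hX)]
  simp only [Metric.pair, bracket, VectorField.mlieBracket_add_right hY hY',
    VectorField.mlieBracket_add_left hY hY', dirDeriv]
  simp
  ring

theorem leviCivita_smul {X Y : VField d M} {f : M → ℝ} {x : M} (hX : DiffAt X x)
    (hf : MDifferentiableAt (𝓡 d) 𝓘(ℝ, ℝ) f x) (hY : DiffAt Y x) :
    leviCivita g X (f • Y) x = dirDeriv X f x • Y x + f x • leviCivita g X Y x := by
  refine leviCivita_eq g hX (hf.smul_section hY) fun Z hZ ↦ ?_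
  have hZ := hZ.diffAt
  have e1 (W : VField d M) : g.pair (f • Y) W = fun y ↦ f y * g.pair Y W y := by
    ext y; simp [Metric.pair]
  have s1 := leviCivita_spec g hX hY hZ
  have e2 : 2 * g.inner x (dirDeriv X f x • Y x + f x • leviCivita g X Y x) (Z x) =
      2 * dirDeriv X f x * g.inner x (Y x) (Z x) + f x * koszul g X Y Z x := by
    rw [← s1]; simp; ring
  rw [e2]
  simp only [koszul, g.pair_comm X (f • Y), g.pair_comm X Y,
    g.pair_comm (bracket X Z), e1]
  rw [dirDeriv_mul X hf (pair_diff g hY hZ), dirDeriv_mul Z hf (pair_diff g hY hX)]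
  simp only [Metric.pair, bracket, VectorField.mlieBracket_smul_right hf hY,
    VectorField.mlieBracket_smul_left hf hY, dirDeriv]
  simp
  ring

theorem leviCivita_zero {X : VField d M} {x : M} (hX : DiffAt X x) :
    leviCivita g X 0 x = 0 := by
  have h0 : DiffAt (0 : VField d M) x := mdifferentiable_zeroSection ..
  have := leviCivita_add g hX h0 h0
  simpa using this

theorem diffAt_sum {ι : Type*} (t : Finset ι) {Y : ι → VField d M} {x : M}
    (hY : ∀ i ∈ t, DiffAt (Y i) x) : DiffAt (∑ i ∈ t, Y i) x := by
  classical
  induction t using Finset.induction_on with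
  | empty => exact mdifferentiable_zeroSection ..
  | insert i t hi ih =>
    rw [Finset.sum_insert hi]
    exact mdifferentiableAt_add_section (hY i (by simp)) (ih fun k hk ↦ hY k (by simp [hk]))

theorem leviCivita_sum {ι : Type*} (t : Finset ι) {X : VField d M} {Y : ι → VField d M} {x : M}
    (hX : DiffAt X x) (hY : ∀ i ∈ t, DiffAt (Y i) x) :
    leviCivita g X (∑ i ∈ t, Y i) x = ∑ i ∈ t, leviCivita g X (Y i) x := by
  classical
  induction t using Finset.induction_on with
  | empty => simpa using leviCivita_zero g hX
  | insert i t hi ih =>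
    have ht : ∀ k ∈ t, DiffAt (Y k) x := fun k hk ↦ hY k (by simp [hk])
    rw [Finset.sum_insert hi, Finset.sum_insert hi,
      leviCivita_add g hX (hY i (by simp)) (diffAt_sum t ht), ih ht]

theorem leviCivita_torsion_free {X Y : VField d M} {x : M} (hX : DiffAt X x) (hY : DiffAt Y x) :
    leviCivita g X Y x - leviCivita g Y X x = bracket X Y x := by
  rw [sub_eq_iff_eq_add]
  refine leviCivita_eq g hX hY fun Z hZ ↦ ?_
  rw [map_add, add_apply, mul_add, leviCivita_spec g hY hX hZ.diffAt]
  have : bracket Y X x = - bracket X Y x := VectorField.mlieBracket_swap_apply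
  simp only [koszul, g.pair_comm Y X, Metric.pair, this]
  simp
  ring

end Connection

/-! ### Metric `f`-structures -/

namespace MetricFStructure

variable {n s : ℕ} {M : Type*} [TopologicalSpace M]
  [ChartedSpace (EuclideanSpace ℝ (Fin (2 * n + s))) M] [IsManifold (𝓡 (2 * n + s)) ∞ M]
  (S : MetricFStructure n s M)

theorem φ_ξ (i : Fin s) (x : M) : S.φ x (S.ξ i x) = 0 := by
  have h1 := S.φ_sq x (S.ξ i x)
  have h2 := S.φ_cube x (S.ξ i x)
  have h3 : S.φ x (S.φ x (S.ξ i x)) = 0 := by simp [h1, S.η_ξ]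
  simpa [h3] using h2

/-- Evaluating `φ²` on `φv` and using `φ³ = -φ` forces `∑ η^i(φv) ξ_i = 0`; the `η^i` are dual to
the `ξ_i`. -/
theorem η_φ (i : Fin s) (x : M) (v : TangentSpace (𝓡 (2 * n + s)) x) : S.η i x (S.φ x v) = 0 := by
  have h1 := S.φ_sq x (S.φ x v)
  rw [eq_neg_of_add_eq_zero_left (S.φ_cube x v), left_eq_add] at h1
  simpa [S.η_ξ] using congrArg (S.η i x) h1

theorem η_eq_inner (i : Fin s) (x : M) (v : TangentSpace (𝓡 (2 * n + s)) x) :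
    S.η i x v = S.g.inner x (S.ξ i x) v := by
  have := S.g_φ x (S.ξ i x) v
  simp [S.φ_ξ, S.η_ξ] at this
  linarith

theorem η_apply_eq_pair (i : Fin s) (X : VField (2 * n + s) M) :
    (fun y ↦ S.η i y (X y)) = S.g.pair (S.ξ i) X := by
  ext y; exact S.η_eq_inner i y _

theorem ξ_diffAt (i : Fin s) (x : M) : DiffAt (S.ξ i) x := (S.smooth_ξ i x).diffAt

theorem η_apply_mdifferentiableAt (i : Fin s) {X : VField (2 * n + s) M} {x : M}
    (hX : DiffAt X x) :
    MDifferentiableAt (𝓡 (2 * n + s)) 𝓘(ℝ, ℝ) (fun y ↦ S.η i y (X y)) x := by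
  rw [η_apply_eq_pair]
  exact pair_diff S.g (S.ξ_diffAt i x) hX

theorem φField_smoothAt {X : VField (2 * n + s) M} {x : M} (hX : SmoothAt X x) :
    SmoothAt (S.φField X) x :=
  ContMDiffAt.clm_bundle_apply (S.smooth_φ x) hX

/-- Recovers `g` from `Φ`, `φ` and the `η^i`, so that their Lie derivatives determine that of `g`.
-/
theorem Φ_φField (X Y : VField (2 * n + s) M) (x : M) :
    S.Φ (S.φField X) Y x = S.g.pair X Y x - ∑ i, S.η i x (X x) * S.η i x (Y x) :=
  S.g_φ x (X x) (Y x)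

theorem fundForm_ξ_left (j : Fin s) (x : M) (v : TangentSpace (𝓡 (2 * n + s)) x) :
    S.fundForm x (S.ξ j x) v = 0 := by
  rw [fundForm, ← η_eq_inner, η_φ]

theorem fundForm_ξ_right (j : Fin s) (x : M) (v : TangentSpace (𝓡 (2 * n + s)) x) :
    S.fundForm x v (S.ξ j x) = 0 := by
  simp [fundForm, φ_ξ]

/-! ### Lie derivatives along `ξ_j`, then `∇ξ_j` and `R(X,Y)ξ_j` -/

variable {S}

theorem IsGenAlmostKenmotsu.dirDeriv_η (hS : S.IsGenAlmostKenmotsu) (i : Fin s) {x : M}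
    {X Y : VField (2 * n + s) M} (hX : SmoothAt X x) (hY : SmoothAt Y x) :
    dirDeriv X (fun y ↦ S.η i y (Y y)) x - dirDeriv Y (fun y ↦ S.η i y (X y)) x
      = S.η i x (bracket X Y x) := by
  have := hS.closed i x X Y hX hY
  rw [dη] at this
  linarith

/-- `L_ξ η = 0`. -/
theorem IsGenAlmostKenmotsu.dirDeriv_ξ_η (hS : S.IsGenAlmostKenmotsu) (i j : Fin s) {x : M}
    {X : VField (2 * n + s) M} (hX : SmoothAt X x) :
    dirDeriv (S.ξ j) (fun y ↦ S.η i y (X y)) x = S.η i x (bracket (S.ξ j) X x) := by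
  rw [← hS.dirDeriv_η i (S.smooth_ξ j x) hX]
  simp only [S.η_ξ, dirDeriv_const, sub_zero]

/-- `L_ξ φ = 0`. -/
theorem IsGenKenmotsu.bracket_ξ_φField (hS : S.IsGenKenmotsu) (j : Fin s) {x : M}
    {X : VField (2 * n + s) M} (hX : SmoothAt X x) :
    bracket (S.ξ j) (S.φField X) x = S.φ x (bracket (S.ξ j) X x) := by
  have h := hS.normal x (S.ξ j) X (S.smooth_ξ j x) hX
  have h0 : S.φField (S.ξ j) = 0 := by ext1 y; exact S.φ_ξ j y
  have hη (i : Fin s) : S.η i x (bracket (S.ξ j) (S.φField X) x) = 0 := by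
    rw [← hS.dirDeriv_ξ_η i j (S.φField_smoothAt hX)]
    simp only [φField, S.η_φ, dirDeriv_const]
  simp only [hS.closed _ x _ _ (S.smooth_ξ j x) hX, nijenhuis, h0, bracket,
    VectorField.mlieBracket_zero_left] at h
  have h1 : S.φ x (S.φ x (bracket (S.ξ j) X x)) = S.φ x (bracket (S.ξ j) (S.φField X) x) := by
    simpa [sub_eq_zero] using h
  -- Applying `φ` turns the left side into `-φ[ξ,X]` and the right side into `-[ξ,φX]`, whose
  -- `ξ_i`-components vanish by `hη`.
  have h2 := congrArg (S.φ x) h1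
  rw [eq_neg_of_add_eq_zero_left (S.φ_cube x _), S.φ_sq] at h2
  simpa [hη] using h2.symm

/-- `L_ξ Φ = 2 Φ`. -/
theorem IsGenAlmostKenmotsu.lie_ξ_Φ (hS : S.IsGenAlmostKenmotsu) (j : Fin s) {x : M}
    {Y Z : VField (2 * n + s) M} (hY : SmoothAt Y x) (hZ : SmoothAt Z x) :
    dirDeriv (S.ξ j) (S.Φ Y Z) x - S.Φ (bracket (S.ξ j) Y) Z x - S.Φ Y (bracket (S.ξ j) Z) x
      = 2 * S.Φ Y Z x := by
  have h := hS.dΦ_eq x (S.ξ j) Y Z (S.smooth_ξ j x) hY hZ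
  have h1 : S.Φ Z (S.ξ j) = fun _ ↦ 0 := by ext y; exact S.fundForm_ξ_right j y _
  have h2 : S.Φ (S.ξ j) Y = fun _ ↦ 0 := by ext y; exact S.fundForm_ξ_left j y _
  have h3 : S.Φ (bracket Y Z) (S.ξ j) x = 0 := S.fundForm_ξ_right j x _
  -- Skew-symmetry of `Φ`: compute `g(φv, φ²w)` once by compatibility of `g` with `φ` and once by
  -- the formula for `φ²`.
  have hskew (v w : TangentSpace (𝓡 (2 * n + s)) x) : S.fundForm x v w = - S.fundForm x w v := by
    have e1 := S.g_φ x v (S.φ x w)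
    have e2 : S.g.inner x (S.φ x v) (S.φ x (S.φ x w)) = - S.g.inner x (S.φ x v) w := by
      have e3 (i : Fin s) : S.g.inner x (S.φ x v) (S.ξ i x) = 0 := by
        rw [S.g.symm, ← η_eq_inner, η_φ]
      rw [S.φ_sq]; simp [e3]
    simp [η_φ] at e1
    rw [fundForm, fundForm, ← e1, e2, S.g.symm x w]
  have h4 : S.Φ (bracket Z (S.ξ j)) Y x = S.Φ Y (bracket (S.ξ j) Z) x := by
    have : bracket Z (S.ξ j) x = - bracket (S.ξ j) Z x := VectorField.mlieBracket_swap_apply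
    simp only [Φ]
    rw [hskew, this]
    simp [fundForm]
  -- The factor `1/3` is common to both sides, and `η^i(ξ_j) = δ_ij` leaves a single summand on the
  -- right.
  rw [dΦ, h1, h2, h3, h4, dirDeriv_const, dirDeriv_const] at h
  simp only [ηwedgeΦ, h1, h2, S.η_ξ] at h
  rw [← Finset.mul_sum] at h
  simp at h
  linarith

/-- `L_ξ g = 2 (g - ∑ η ⊗ η)`. -/
theorem IsGenKenmotsu.lie_ξ_g (hS : S.IsGenKenmotsu) (j : Fin s) {x : M}
    {Y Z : VField (2 * n + s) M} (hY : SmoothAt Y x) (hZ : SmoothAt Z x) :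
    dirDeriv (S.ξ j) (S.g.pair Y Z) x - S.g.pair (bracket (S.ξ j) Y) Z x
        - S.g.pair Y (bracket (S.ξ j) Z) x
      = 2 * (S.g.pair Y Z x - ∑ i, S.η i x (Y x) * S.η i x (Z x)) := by
  have h := hS.lie_ξ_Φ j (S.φField_smoothAt hY) hZ
  have h1 : S.Φ (S.φField Y) Z = fun y ↦ S.g.pair Y Z y - ∑ i, S.η i y (Y y) * S.η i y (Z y) := by
    ext y; exact S.Φ_φField Y Z y
  have h2 : S.Φ (bracket (S.ξ j) (S.φField Y)) Z x = S.Φ (S.φField (bracket (S.ξ j) Y)) Z x := by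
    simp only [Φ, hS.bracket_ξ_φField j hY, φField]
  have hd (i : Fin s) : MDifferentiableAt (𝓡 (2 * n + s)) 𝓘(ℝ, ℝ)
      (fun y ↦ S.η i y (Y y) * S.η i y (Z y)) x :=
    (S.η_apply_mdifferentiableAt i hY.diffAt).mul (S.η_apply_mdifferentiableAt i hZ.diffAt)
  -- Expands `L_ξ Φ = 2Φ` on `(φY, Z)`. The `η^i ⊗ η^i` terms drop out because `L_ξ η^i = 0`.
  rw [h2, Φ_φField, Φ_φField, h1,
    dirDeriv_sub _ (pair_diff S.g hY.diffAt hZ.diffAt)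
      (mdifferentiableAt_finset_sum _ fun i _ ↦ hd i),
    dirDeriv_sum _ _ fun i _ ↦ hd i] at h
  simp only [dirDeriv_mul _ (S.η_apply_mdifferentiableAt _ hY.diffAt)
    (S.η_apply_mdifferentiableAt _ hZ.diffAt), hS.dirDeriv_ξ_η _ j hY, hS.dirDeriv_ξ_η _ j hZ,
    Finset.sum_add_distrib] at h
  have h3 : ∑ i, S.η i x (Z x) * S.η i x (bracket (S.ξ j) Y x)
      = ∑ i, S.η i x (bracket (S.ξ j) Y x) * S.η i x (Z x) :=
    Finset.sum_congr rfl fun i _ ↦ mul_comm _ _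
  linarith

/-- `∇_X ξ = X - ∑ η^i(X) ξ_i`. -/
theorem IsGenKenmotsu.leviCivita_ξ (hS : S.IsGenKenmotsu) (j : Fin s) {x : M}
    {X : VField (2 * n + s) M} (hX : DiffAt X x) :
    leviCivita S.g X (S.ξ j) x = X x - ∑ i, S.η i x (X x) • S.ξ i x := by
  obtain ⟨X', hX', hXx⟩ := exists_smoothAt_extension (X x)
  rw [leviCivita_congr_left S.g hX hX'.diffAt (S.ξ_diffAt j x) hXx.symm, ← hXx]
  refine leviCivita_eq S.g hX'.diffAt (S.ξ_diffAt j x) fun Z hZ ↦ ?_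
  have h1 := hS.lie_ξ_g j hX' hZ
  have h2 := hS.dirDeriv_η j hX' hZ
  have h3 : S.g.pair (bracket X' (S.ξ j)) Z x = - S.g.pair (bracket (S.ξ j) X') Z x := by
    have : bracket X' (S.ξ j) x = - bracket (S.ξ j) X' x := VectorField.mlieBracket_swap_apply
    simp [Metric.pair, this]
  have h4 : S.g.inner x (X' x - ∑ i, S.η i x (X' x) • S.ξ i x) (Z x)
      = S.g.pair X' Z x - ∑ i, S.η i x (X' x) * S.η i x (Z x) := by
    simp [Metric.pair, S.η_eq_inner]
  -- With `ξ_j` in the second slot, the six Koszul terms split into `(L_ξ g)(X',Z)`, which is `h1`,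
  -- and `2 dη^j(X',Z)`, which vanishes by `h2`.
  rw [h4, koszul, h3, S.g.pair_comm X' (S.ξ j), S.g.pair_comm (bracket X' Z),
    S.g.pair_comm (bracket (S.ξ j) Z), ← S.η_apply_eq_pair, ← S.η_apply_eq_pair,
    ← S.η_apply_eq_pair]
  linarith

theorem IsGenKenmotsu.leviCivita_leviCivita_ξ (hS : S.IsGenKenmotsu) (j : Fin s) {x : M}
    {X Y : VField (2 * n + s) M} (hX : SmoothAt X x) (hY : SmoothAt Y x) :
    leviCivita S.g X (leviCivita S.g Y (S.ξ j)) x = leviCivita S.g X Y x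
      - ∑ i, (dirDeriv X (fun y ↦ S.η i y (Y y)) x • S.ξ i x
        + S.η i x (Y x) • (X x - ∑ k, S.η k x (X x) • S.ξ k x)) := by
  -- The outer derivative needs `∇_Y ξ_j` on a whole neighbourhood, where `Y` is still
  -- differentiable.
  have e : leviCivita S.g Y (S.ξ j) =ᶠ[nhds x]
      Y + ∑ i, (fun y ↦ -S.η i y (Y y)) • S.ξ i := by
    filter_upwards [hY.eventually_diffAt] with y hy
    simp [hS.leviCivita_ξ j hy, sub_eq_add_neg]
    rfl
  have hη (i : Fin s) := S.η_apply_mdifferentiableAt i hY.diffAt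
  have hd (i : Fin s) : DiffAt ((fun y ↦ -S.η i y (Y y)) • S.ξ i) x :=
    (hη i).neg.smul_section (S.ξ_diffAt i x)
  rw [leviCivita_congr_right S.g e, leviCivita_add S.g hX.diffAt hY.diffAt (diffAt_sum _ fun i _ ↦ hd i),
    leviCivita_sum S.g _ hX.diffAt fun i _ ↦ hd i, sub_eq_add_neg, ← Finset.sum_neg_distrib]
  congr 1
  refine Finset.sum_congr rfl fun i _ ↦ ?_
  have hn : dirDeriv X (fun y ↦ -S.η i y (Y y)) x = - dirDeriv X (fun y ↦ S.η i y (Y y)) x := by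
    have := dirDeriv_sub X (mdifferentiableAt_const (c := (0 : ℝ))) (hη i)
    simpa [dirDeriv_const] using this
  rw [leviCivita_smul (f := fun y ↦ -S.η i y (Y y)) S.g hX.diffAt (hη i).neg (S.ξ_diffAt i x), hS.leviCivita_ξ i hX.diffAt, hn]
  module

/-- `R(X,Y) ξ_j = ∑ (η^i(X) (Y - ∑ η^k(Y) ξ_k) - η^i(Y) (X - ∑ η^k(X) ξ_k))`. -/
theorem IsGenKenmotsu.curvature_ξ (hS : S.IsGenKenmotsu) (j : Fin s) {x : M}
    {X Y : VField (2 * n + s) M} (hX : SmoothAt X x) (hY : SmoothAt Y x) :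
    curvature S.g X Y (S.ξ j) x =
      ∑ i, (S.η i x (X x) • (Y x - ∑ k, S.η k x (Y x) • S.ξ k x)
        - S.η i x (Y x) • (X x - ∑ k, S.η k x (X x) • S.ξ k x)) := by
  rw [curvature, hS.leviCivita_leviCivita_ξ j hX hY, hS.leviCivita_leviCivita_ξ j hY hX,
    hS.leviCivita_ξ j (diffAt_bracket hX hY),
    ← leviCivita_torsion_free S.g hX.diffAt hY.diffAt]
  -- Closedness of `η^i` makes the derivatives `X η^i(Y) - Y η^i(X)` cancel the `ξ_i`-components of
  -- `∇_[X,Y] ξ_j`; torsion-freeness cancels the rest of that term.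
  have h : ∑ i, S.η i x (leviCivita S.g X Y x - leviCivita S.g Y X x) • S.ξ i x
      = ∑ i, (dirDeriv X (fun y ↦ S.η i y (Y y)) x • S.ξ i x
        - dirDeriv Y (fun y ↦ S.η i y (X y)) x • S.ξ i x) := by
    refine Finset.sum_congr rfl fun i _ ↦ ?_
    rw [leviCivita_torsion_free S.g hX.diffAt hY.diffAt, ← hS.dirDeriv_η i hX hY, sub_smul]
  rw [h]
  simp only [Finset.sum_add_distrib, Finset.sum_sub_distrib]
  abel

end MetricFStructure

end GenKenmotsu

theorem mainTheorem10 {n s m : ℕ}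
    {N : Type*} [TopologicalSpace N] [ChartedSpace (EuclideanSpace ℝ (Fin (2 * n + s))) N]
    [IsManifold (𝓡 (2 * n + s)) ∞ N]
    {M : Type*} [TopologicalSpace M] [ChartedSpace (EuclideanSpace ℝ (Fin m)) M]
    [IsManifold (𝓡 m) ∞ M]
    (S : GenKenmotsu.MetricFStructure n s N) (hS : S.IsGenKenmotsu)
    (f : M → N) (hf : GenKenmotsu.IsInvariantSubmanifold m S f)
    (j : Fin s) (p : M) (X Y : GenKenmotsu.VField (2 * n + s) N)
    (hX : GenKenmotsu.SmoothAt X (f p)) (hY : GenKenmotsu.SmoothAt Y (f p))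
    (hXt : X (f p) ∈ GenKenmotsu.tangentSub (2 * n + s) m f p)
    (hYt : Y (f p) ∈ GenKenmotsu.tangentSub (2 * n + s) m f p) :
    GenKenmotsu.curvature S.g X Y (S.ξ j) (f p) ∈ GenKenmotsu.tangentSub (2 * n + s) m f p := by
  rw [hS.curvature_ξ j hX hY]
  -- Projection onto the common kernel of the `η^k` along the `ξ_k` preserves any subspace
  -- containing the `ξ_k`.
  have hproj {v : TangentSpace (𝓡 (2 * n + s)) (f p)}
      (hv : v ∈ GenKenmotsu.tangentSub (2 * n + s) m f p) :
      v - ∑ k, S.η k (f p) v • S.ξ k (f p) ∈ GenKenmotsu.tangentSub (2 * n + s) m f p :=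
    sub_mem hv (sum_mem fun k _ ↦ Submodule.smul_mem _ _ (hf.ξ_mem k p))
  exact sum_mem fun i _ ↦ sub_mem (Submodule.smul_mem _ _ (hproj hYt))
    (Submodule.smul_mem _ _ (hproj hXt))
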